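/- Let $R$ be an associative ring with identity and let $n\ge 1$ be an integer. Let $\mathcal E_n$ be the category whose objects are the right $R$-modules $M$ with a fixed chain of submodules $0=M^{(0)}\le M^{(1)}\le\dots\le M^{(n)}=M$, and whose morphisms $f\colon M\to N$ are the right $R$-module morphisms with $f(M^{(i)})\subseteq N^{(i)}$ for every $i=1,\dots,n$. Such a morphism induces right $R$-module morphisms $f_i\colon M^{(i)}/M^{(i-1)}\to N^{(i)}/N^{(i-1)}$ for $i=1,\dots,n$. Finite direct sums in $\mathcal E_n$ are formed termwise: $\bigl(\bigoplus_k M_k\bigr)^{(i)}=\bigoplus_k M_k^{(i)}$. Let $\mathcal U_n$ be the full subcategory of $\mathcal E_n$ whose objects are those $M$ for which all the factor modules $M^{(i)}/M^{(i-1)}$, $i=1,\dots,n$, are non-zero and uniserial (a module is uniserial if its submodules are linearly ordered by inclusion). For objects $M,N$ of $\mathcal E_n$ and $i=1,\dots,n$, write $[M]_{i,m}=[N]_{i,m}$ (respectively $[M]_{i,e}=[N]_{i,e}$) if there exist morphisms $f\colon M\to N$ and $g\colon N\to M$ in $\mathcal E_n$ such that $f_i$ and $g_i$ are both injective (respectively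 both surjective). **Proposition.** Let $M_1,\dots,M_r,N_1,\dots,N_s$ ($r,s\ge 0$) be objects of $\mathcal U_n$. Then $\bigoplus_{k=1}^r M_k\cong\bigoplus_{l=1}^s N_l$ in the category $\mathcal E_n$ if and only if $r=s$ and there exist $2n$ permutations $\varphi_{i,a}$ of $\{1,\dots,r\}$, where $i=1,\dots,n$ and $a\in\{m,e\}$, such that $[M_k]_{i,a}=[N_{\varphi_{i,a}(k)}]_{i,a}$ for every $i=1,\dots,n$, every $a\in\{m,e\}$ and every $k=1,\dots,r$. -/

import Mathlib

open CategoryTheory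

universe u v

/-- A module is uniserial if any two of its submodules are comparable under inclusion. -/
def IsUniserialModule (S : Type u) [Ring S] (X : Type v) [AddCommGroup X] [Module S X] : Prop :=
  ∀ A B : Submodule S X, A ≤ B ∨ B ≤ A

/-- An `S`-module `M` with a fixed chain of submodules `0 = M⁽⁰⁾ ≤ M⁽¹⁾ ≤ ⋯ ≤ M⁽ⁿ⁾ = M`.
For a ring `R`, taking `S = Rᵐᵒᵖ` gives right `R`-modules with such a chain, that is, the objects
of the category `ℰ_n` over `R`. -/
structure ChainModule (S : Type u) [Ring S] (n : ℕ) where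
  carrier : Type v
  [addCommGroup : AddCommGroup carrier]
  [module : Module S carrier]
  /-- The chain of submodules `M⁽⁰⁾, …, M⁽ⁿ⁾`. -/
  sub : Fin (n + 1) → Submodule S carrier
  monotone_sub : Monotone sub
  sub_zero : sub 0 = ⊥
  sub_last : sub (Fin.last n) = ⊤

namespace ChainModule

attribute [instance] ChainModule.addCommGroup ChainModule.module

variable {S : Type u} [Ring S] {n : ℕ}

/-- A morphism of chains: a linear map `f : M → N` with `f(M⁽ʲ⁾) ⊆ N⁽ʲ⁾` for every `j`. -/
@[ext]
structure Hom (M N : ChainModule.{u, v} S n) where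
  toLin : M.carrier →ₗ[S] N.carrier
  map_sub : ∀ (j : Fin (n + 1)) (x : M.carrier), x ∈ M.sub j → toLin x ∈ N.sub j

/-- The category `ℰ_n`, with composition of linear maps. -/
instance : Category (ChainModule.{u, v} S n) where
  Hom M N := Hom M N
  id M := ⟨LinearMap.id, fun _ _ hx => hx⟩
  comp f g := ⟨g.toLin ∘ₗ f.toLin, fun j x hx => g.map_sub j _ (f.map_sub j x hx)⟩

/-- The factor module `M⁽ⁱ⁾ / M⁽ⁱ⁻¹⁾`. The index `i : Fin n` runs through `0, …, n - 1` and stands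
for the `(i + 1)`-st factor in the usual numbering `1, …, n`: the submodules involved are
`M.sub i.succ` and `M.sub i.castSucc`. -/
abbrev Factor (M : ChainModule.{u, v} S n) (i : Fin n) : Type v :=
  (M.sub i.succ) ⧸ (M.sub i.castSucc).submoduleOf (M.sub i.succ)

/-- The linear map `f_i : M⁽ⁱ⁾ / M⁽ⁱ⁻¹⁾ → N⁽ⁱ⁾ / N⁽ⁱ⁻¹⁾` induced by a morphism `f : M ⟶ N`. -/
def inducedMap {M N : ChainModule.{u, v} S n} (f : M ⟶ N) (i : Fin n) :
    M.Factor i →ₗ[S] N.Factor i :=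
  Submodule.mapQ _ _ ((Hom.toLin f).restrict (Hom.map_sub f i.succ))
    (fun x hx => Hom.map_sub f i.castSucc (x : M.carrier) hx)

/-- Membership in the full subcategory `𝒰_n`: all factor modules are non-zero and uniserial. -/
def IsU (M : ChainModule.{u, v} S n) : Prop :=
  ∀ i : Fin n, Nontrivial (M.Factor i) ∧ IsUniserialModule S (M.Factor i)

/-- The two kinds of classes: monogeny (`m`) and epigeny (`e`). -/
inductive Kind
  | m
  | e

/-- `[M]_{i,a} = [N]_{i,a}`: there are morphisms `f : M ⟶ N` and `g : N ⟶ M` of chains whose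
`i`-th induced maps are both injective (for `a = m`), respectively both surjective
(for `a = e`). -/
def SameClass (i : Fin n) : Kind → ChainModule.{u, v} S n → ChainModule.{u, v} S n → Prop
  | Kind.m, M, N => ∃ (f : M ⟶ N) (g : N ⟶ M),
      Function.Injective (inducedMap f i) ∧ Function.Injective (inducedMap g i)
  | Kind.e, M, N => ∃ (f : M ⟶ N) (g : N ⟶ M),
      Function.Surjective (inducedMap f i) ∧ Function.Surjective (inducedMap g i)

/-- The direct sum `M_1 ⊕ ⋯ ⊕ M_r` in `ℰ_n`: the direct sum of the modules (realised, the family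
being finite, as the module of all families `(x_k)_k`), with the chain whose `j`-th term is
`M_1⁽ʲ⁾ ⊕ ⋯ ⊕ M_r⁽ʲ⁾`. -/
abbrev directSum {r : ℕ} (M : Fin r → ChainModule.{u, v} S n) : ChainModule.{u, v} S n where
  carrier := (k : Fin r) → (M k).carrier
  sub j := Submodule.pi Set.univ (fun k => (M k).sub j)
  monotone_sub := fun _ _ h _ hx k hk => (M k).monotone_sub h (hx k hk)
  sub_zero := by simp [sub_zero]
  sub_last := by simp [sub_last]

end ChainModule

/-!
For `i = 1, …, n`, the morphisms `f` of `𝒰_n` with `f_i` not injective, and those with `f_i` not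
surjective, form completely prime ideals `P_{i,m}` and `P_{i,e}`: sums of non-injective
(non-surjective) maps between non-zero uniserial modules are again such, and a composite is
injective (surjective) only if both factors are. By the five lemma along the chains, a morphism
outside all `2n` ideals is an isomorphism. Two objects have the same `(i, a)`-class if there are
morphisms in both directions outside `P_{i,a}`.

**Necessity** (`ChainModule.card_class_le`). Let the matrices `f` and `g` represent an isomorphism
of the direct sums and its inverse, and fix a class for `(i, a)`. A path `M_k → N_l → M_k'` with
`M_k`, `M_k'` in the class and `N_l` outside it lies in `P_{i,a}`. So modulo `P_{i,a}` the blocks of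
`f` and `g` on the class still compose to the identity. For `a = m` this yields, on non-zero
submodules of the factors of the `M_k` in the class, an embedding of their direct sum in the direct
sum of the factors of the `N_l` in the class. The latter are uniserial, so comparing Goldie
dimensions shows that the class occurs at most as often among the `M_k` as among the `N_l`. For
`a = e` the same works with quotients and the dual Goldie dimension. By symmetry every class occurs
equally often on both sides, which gives the bijections.

**Sufficiency** (`CompletelyPrimeIdeal.nonempty_iso`). This holds for any finite family of
completely prime ideals `P_t` that detects automorphisms. The maximal members among the ideals of
`End M` have division rings as quotients and are separated as in the Chinese remainder
theorem. Several labels `t` may give the same maximal ideal of `End M`, and the corresponding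
bijections may differ; therefore only the least label of each maximal ideal, called dominant, is
used. Whether `t` is dominant for `M` depends only on the `t`-class of `M`. For each dominant `t`,
lift mutually inverse isomorphisms modulo `P_t` between matched summands to morphisms that vanish
modulo the other dominant ideals. The sum of these over all `t` gives matrices whose two products
agree with the identity modulo the radical, so they are isomorphisms.
-/

/-! ### Uniserial modules -/

namespace IsUniserialModule

variable {S : Type u} [Ring S] {X Y Z : Type v} [AddCommGroup X] [Module S X]
  [AddCommGroup Y] [Module S Y] [AddCommGroup Z] [Module S Z]

theorem mem_span_or_mem_span (h : IsUniserialModule S X) (x y : X) :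
    (∃ a : S, a • x = y) ∨ ∃ a : S, a • y = x := by
  rcases h (S ∙ x) (S ∙ y) with H | H
  · exact .inr (Submodule.mem_span_singleton.1 (H (Submodule.mem_span_singleton_self x)))
  · exact .inl (Submodule.mem_span_singleton.1 (H (Submodule.mem_span_singleton_self y)))

theorem inf_ne_bot (h : IsUniserialModule S X) {A B : Submodule S X} (hA : A ≠ ⊥) (hB : B ≠ ⊥) :
    A ⊓ B ≠ ⊥ := by
  rcases h A B with H | H
  · rwa [inf_eq_left.2 H]
  · rwa [inf_eq_right.2 H]

theorem sup_ne_top (h : IsUniserialModule S X) {A B : Submodule S X} (hA : A ≠ ⊤) (hB : B ≠ ⊤) :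
    A ⊔ B ≠ ⊤ := by
  rcases h A B with H | H
  · rwa [sup_eq_right.2 H]
  · rwa [sup_eq_left.2 H]

theorem finset_inf_ne_bot [Nontrivial X] (h : IsUniserialModule S X) {ι : Type*} (s : Finset ι)
    (A : ι → Submodule S X) (hA : ∀ i ∈ s, A i ≠ ⊥) : s.inf A ≠ ⊥ :=
  Finset.inf_induction (p := fun B => B ≠ ⊥) top_ne_bot (fun _ ha _ hb => h.inf_ne_bot ha hb) hA

theorem finset_sup_ne_top [Nontrivial X] (h : IsUniserialModule S X) {ι : Type*} (s : Finset ι)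
    (A : ι → Submodule S X) (hA : ∀ i ∈ s, A i ≠ ⊤) : s.sup A ≠ ⊤ :=
  Finset.sup_induction (p := fun B => B ≠ ⊤) bot_ne_top (fun _ ha _ hb => h.sup_ne_top ha hb) hA

theorem not_injective_add (h : IsUniserialModule S X) {f g : X →ₗ[S] Y}
    (hf : ¬ Function.Injective f) (hg : ¬ Function.Injective g) :
    ¬ Function.Injective (f + g) := by
  rw [← LinearMap.ker_eq_bot] at *
  refine fun H => h.inf_ne_bot hf hg (eq_bot_iff.2 ?_)
  rintro x ⟨hx, hx'⟩
  simp only [SetLike.mem_coe, LinearMap.mem_ker] at hx hx'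
  rw [← H, LinearMap.mem_ker, LinearMap.add_apply, hx, hx', add_zero]

theorem not_surjective_add (h : IsUniserialModule S Y) {f g : X →ₗ[S] Y}
    (hf : ¬ Function.Surjective f) (hg : ¬ Function.Surjective g) :
    ¬ Function.Surjective (f + g) := by
  rw [← LinearMap.range_eq_top] at *
  refine fun H => h.sup_ne_top hf hg (eq_top_iff.2 ?_)
  rw [← H]
  rintro _ ⟨x, rfl⟩
  exact add_mem (Submodule.mem_sup_left ⟨x, rfl⟩) (Submodule.mem_sup_right ⟨x, rfl⟩)

theorem injective_comp_iff [Nontrivial X] (h : IsUniserialModule S Y) {f : X →ₗ[S] Y}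
    {g : Y →ₗ[S] Z} :
    Function.Injective (g ∘ₗ f) ↔ Function.Injective f ∧ Function.Injective g := by
  refine ⟨fun H => ?_, fun H => by simpa using H.2.comp H.1⟩
  have hf : Function.Injective f := Function.Injective.of_comp (f := g) (by simpa using H)
  refine ⟨hf, ?_⟩
  by_contra hg
  rw [← LinearMap.ker_eq_bot] at hg
  obtain ⟨x, hx⟩ := exists_ne (0 : X)
  refine h.inf_ne_bot hg (B := LinearMap.range f) ?_ (eq_bot_iff.2 ?_)
  · intro h0
    rw [LinearMap.range_eq_bot] at h0
    exact hx (hf (by simp [h0]))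
  · rintro _ ⟨hy, ⟨z, rfl⟩⟩
    have : z = 0 := H (by simpa using hy)
    simp [this]

theorem surjective_comp_iff [Nontrivial Z] (h : IsUniserialModule S Y) {f : X →ₗ[S] Y}
    {g : Y →ₗ[S] Z} :
    Function.Surjective (g ∘ₗ f) ↔ Function.Surjective f ∧ Function.Surjective g := by
  refine ⟨fun H => ?_, fun H => by simpa using H.2.comp H.1⟩
  have hg : Function.Surjective g := Function.Surjective.of_comp (g := f) (by simpa using H)
  refine ⟨?_, hg⟩
  by_contra hf
  rw [← LinearMap.range_eq_top] at hf
  obtain ⟨z, hz⟩ := exists_ne (0 : Z)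
  refine h.sup_ne_top hf (B := LinearMap.ker g) ?_ (eq_top_iff.2 ?_)
  · intro h0
    obtain ⟨y, rfl⟩ := hg z
    exact hz (LinearMap.mem_ker.1 (h0 ▸ Submodule.mem_top))
  · intro y _
    obtain ⟨x, hx⟩ := H (g y)
    have h1 : y - f x ∈ LinearMap.ker g := by
      simp only [LinearMap.coe_comp, Function.comp_apply] at hx
      simp [hx]
    have h2 : f x ∈ LinearMap.range f := ⟨x, rfl⟩
    simpa using add_mem (Submodule.mem_sup_left h2) (Submodule.mem_sup_right h1)

end IsUniserialModule

/-! ### Goldie dimension and dual Goldie dimension of sums of uniserial modules -/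

section GoldieDimension

variable {S : Type u} [Ring S] {κ ι : Type*}

/-- A module embedded by coordinates `p l` in a product of uniserial modules contains at most
`t.card` non-zero elements that generate an internal direct sum and whose coordinates outside `t`
vanish. This bounds the Goldie dimension of a direct sum of uniserial modules; the induction step
is Gaussian elimination of one coordinate. -/
theorem card_le_of_independent {X : Type*} [AddCommGroup X] [Module S X] {V : ι → Type v}
    [∀ l, AddCommGroup (V l)] [∀ l, Module S (V l)] (hV : ∀ l, IsUniserialModule S (V l))
    (p : ∀ l, X →ₗ[S] V l) (hp : ∀ x, (∀ l, p l x = 0) → x = 0) (t : Finset ι) (s : Finset κ)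
    (x : κ → X) (hx : ∀ k ∈ s, x k ≠ 0) (ht : ∀ k ∈ s, ∀ l ∉ t, p l (x k) = 0)
    (hind : ∀ a : κ → S, ∑ k ∈ s, a k • x k = 0 → ∀ k ∈ s, a k • x k = 0) :
    s.card ≤ t.card := by
  classical
  induction t using Finset.induction_on generalizing s x with
  | empty =>
    rw [Finset.card_empty, Nat.le_zero, Finset.card_eq_zero, Finset.eq_empty_iff_forall_notMem]
    exact fun k hk => hx k hk (hp _ fun l => ht k hk l (Finset.notMem_empty l))
  | insert i t hi ih =>
    rw [Finset.card_insert_of_notMem hi]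
    by_cases hall : ∀ k ∈ s, ∃ a : S, a • x k ≠ 0 ∧ p i (a • x k) = 0
    · have : ∀ k, ∃ a : S, k ∈ s → a • x k ≠ 0 ∧ p i (a • x k) = 0 := fun k => by
        by_cases hk : k ∈ s
        · obtain ⟨a, ha⟩ := hall k hk
          exact ⟨a, fun _ => ha⟩
        · exact ⟨0, fun h => absurd h hk⟩
      choose a ha using this
      refine (ih s (fun k => a k • x k) (fun k hk => (ha k hk).1) ?_ ?_).trans (Nat.le_succ _)
      · intro k hk l hl
        by_cases hli : l = i
        · exact hli ▸ (ha k hk).2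
        · rw [map_smul, ht k hk l (by simp [hli, hl]), smul_zero]
      · intro c hc k hk
        simp only [smul_smul] at hc ⊢
        exact hind (fun k => c k * a k) hc k hk
    · push Not at hall
      obtain ⟨k₀, hk₀, hinj⟩ := hall
      replace hinj : ∀ a : S, p i (a • x k₀) = 0 → a • x k₀ = 0 := fun a h => by
        by_contra h'
        exact hinj a h' h
      -- Subtract a multiple of `x k₀` from a multiple of `x k` to kill the coordinate `i`.
      have : ∀ k, ∃ a b : S, k ∈ s.erase k₀ → a • x k ≠ 0 ∧ p i (a • x k + b • x k₀) = 0 := by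
        intro k
        by_cases hk : k ∈ s.erase k₀
        swap
        · exact ⟨0, 0, fun h => absurd h hk⟩
        rcases (hV i).mem_span_or_mem_span (p i (x k₀)) (p i (x k)) with ⟨c, hc⟩ | ⟨c, hc⟩
        · refine ⟨1, -c, fun _ => ⟨by simpa using hx k (Finset.mem_of_mem_erase hk), ?_⟩⟩
          simp [hc]
        · refine ⟨c, -1, fun _ => ⟨fun h => hx k₀ hk₀ ?_, by simp [hc]⟩⟩
          have := hinj 1 (by rw [one_smul, ← hc, ← map_smul, h, map_zero])
          simpa using this
      choose a b hab using this
      -- A relation among the new elements is a relation among the old ones.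
      have key : ∀ c : κ → S, ∑ k ∈ s.erase k₀, c k • (a k • x k + b k • x k₀) = 0 →
          ∀ k ∈ s.erase k₀, c k • a k • x k = 0 := by
        intro c hc k hk
        have := hind (fun j => if j = k₀ then ∑ k ∈ s.erase k₀, c k * b k else c j * a j) ?_ k
          (Finset.mem_of_mem_erase hk)
        · simpa [Finset.ne_of_mem_erase hk, smul_smul] using this
        · rw [← Finset.add_sum_erase _ _ hk₀, ← hc, if_pos rfl, Finset.sum_smul,
            ← Finset.sum_add_distrib]
          refine Finset.sum_congr rfl fun j hj => ?_
          simp only [Finset.ne_of_mem_erase hj, if_false, smul_add, smul_smul]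
          rw [add_comm]
      have hle := ih (s.erase k₀) (fun k => a k • x k + b k • x k₀) ?_ ?_ ?_
      · have := Finset.card_erase_of_mem hk₀
        omega
      · intro k hk h0
        refine (hab k hk).1 ?_
        have := key (fun j => if j = k then 1 else 0) ?_ k hk
        · simpa using this
        · refine Finset.sum_eq_zero fun j _ => ?_
          by_cases hj : j = k
          · subst hj
            simpa using h0
          · simp [hj]
      · intro k hk l hl
        by_cases hli : l = i
        · exact hli ▸ (hab k hk).2
        · rw [map_add, map_smul, map_smul, ht k (Finset.mem_of_mem_erase hk) l (by simp [hli, hl]),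
            ht k₀ hk₀ l (by simp [hli, hl]), smul_zero, smul_zero, add_zero]
      · intro c hc k hk
        have h1 := key c hc k hk
        have h2 := (hab k hk).2
        have h3 : c k • b k • x k₀ = 0 := by
          rw [smul_smul]
          refine hinj _ ?_
          have h4 : p i (c k • (a k • x k + b k • x k₀)) = 0 := by rw [map_smul, h2, smul_zero]
          rwa [smul_add, h1, zero_add, smul_smul] at h4
        simp only [smul_add, h1, h3, add_zero]

/-- The dual of `card_le_of_independent`: if a module is generated by uniserial submodules `H l`,
then the number of members of a coindependent family of proper submodules `W k` (`k ∈ s`)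
containing all `H l` with `l ∉ t` is at most `t.card`. Coindependence says that the module maps
onto the direct sum of its quotients by the `W k`. -/
theorem card_le_of_coindependent {X : Type*} [AddCommGroup X] [Module S X]
    (H : ι → Submodule S X) (hH : ∀ l, ∀ A B : Submodule S X, A ≤ H l → B ≤ H l → A ≤ B ∨ B ≤ A)
    (hsup : ⨆ l, H l = ⊤) (t : Finset ι) (s : Finset κ) (W : κ → Submodule S X)
    (hW : ∀ k ∈ s, W k ≠ ⊤) (ht : ∀ k ∈ s, ∀ l ∉ t, H l ≤ W k)
    (hco : ∀ y : κ → X, ∃ x, ∀ k ∈ s, x - y k ∈ W k) :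
    s.card ≤ t.card := by
  classical
  induction t using Finset.induction_on generalizing s W with
  | empty =>
    rw [Finset.card_empty, Nat.le_zero, Finset.card_eq_zero, Finset.eq_empty_iff_forall_notMem]
    refine fun k hk => hW k hk (eq_top_iff.2 ?_)
    rw [← hsup]
    exact iSup_le fun l => ht k hk l (Finset.notMem_empty l)
  | insert i t hi ih =>
    rw [Finset.card_insert_of_notMem hi]
    by_cases hall : ∀ k ∈ s, W k ⊔ H i ≠ ⊤
    · refine (ih s (fun k => W k ⊔ H i) hall ?_ ?_).trans (Nat.le_succ _)
      · intro k hk l hl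
        by_cases hli : l = i
        · exact hli ▸ le_sup_right
        · exact (ht k hk l (by simp [hli, hl])).trans le_sup_left
      · intro y
        obtain ⟨x, hx⟩ := hco y
        exact ⟨x, fun k hk => Submodule.mem_sup_left (hx k hk)⟩
    · push Not at hall
      obtain ⟨k₀, hk₀, htop⟩ := hall
      have hle := ih (s.erase k₀) (fun k => (W k ⊓ W k₀) ⊔ H i) ?_ ?_ ?_
      · have := Finset.card_erase_of_mem hk₀
        omega
      · -- A uniserial module does not map onto the direct sum of two non-zero modules.
        intro k hk h
        have key : ∀ j j', j ∈ s → j' ∈ s → j ≠ j' → (W j ⊓ W j') ⊔ H i = ⊤ →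
            ¬ (H i ⊓ W j ≤ H i ⊓ W j') := by
          intro j j' hj hj' hne h hle
          refine hW j' hj' (eq_top_iff.2 fun z _ => ?_)
          obtain ⟨y, hy⟩ := hco (fun m => if m = j then 0 else z)
          have hyj := hy j hj
          have hyj' := hy j' hj'
          simp only [if_true, sub_zero, hne.symm, if_false] at hyj hyj'
          obtain ⟨w, hw, e, he, rfl⟩ := Submodule.mem_sup.1 (h ▸ Submodule.mem_top (x := y))
          have hej : e ∈ W j := by simpa using sub_mem hyj hw.1
          have := sub_mem (add_mem hw.2 (hle ⟨he, hej⟩).2) hyj'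
          simpa using this
        have hne := Finset.ne_of_mem_erase hk
        have hks := Finset.mem_of_mem_erase hk
        rcases hH i (H i ⊓ W k) (H i ⊓ W k₀) inf_le_left inf_le_left with h' | h'
        · exact key k k₀ hks hk₀ hne h h'
        · exact key k₀ k hk₀ hks hne.symm (by rwa [inf_comm]) h'
      · intro k hk l hl
        by_cases hli : l = i
        · exact hli ▸ le_sup_right
        · exact (le_inf (ht k (Finset.mem_of_mem_erase hk) l (by simp [hli, hl]))
            (ht k₀ hk₀ l (by simp [hli, hl]))).trans le_sup_left
      · intro y
        have : ∀ k, ∃ w ∈ W k₀, ∃ e ∈ H i, w + e = y k := fun k =>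
          Submodule.mem_sup.1 (htop ▸ Submodule.mem_top)
        choose w hw e he hwe using this
        obtain ⟨x, hx⟩ := hco (fun k => if k = k₀ then 0 else w k)
        refine ⟨x, fun k hk => ?_⟩
        have h1 := hx k (Finset.mem_of_mem_erase hk)
        have h2 := hx k₀ hk₀
        simp only [Finset.ne_of_mem_erase hk, if_false, if_true, sub_zero] at h1 h2
        rw [← hwe, ← sub_sub, sub_eq_add_neg]
        exact add_mem (Submodule.mem_sup_left ⟨h1, sub_mem h2 (hw k)⟩)
          (Submodule.mem_sup_right (neg_mem (he k)))

variable [Fintype ι] {U : κ → Type v} [∀ k, AddCommGroup (U k)] [∀ k, Module S (U k)]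
  {V : ι → Type v} [∀ l, AddCommGroup (V l)] [∀ l, Module S (V l)]

/-- If `⊕ U k` is a direct summand of `⊕ V l`, through matrices `f` and `g`, and the paths from
`U k` to `U k'` (`k, k' ∈ s`) through the `V l` with `l ∉ t` are not injective, then
`s.card ≤ t.card`. -/
theorem card_le_of_not_injective [∀ k, Nontrivial (U k)] (hU : ∀ k, IsUniserialModule S (U k))
    (hV : ∀ l, IsUniserialModule S (V l)) (f : ∀ k l, U k →ₗ[S] V l) (g : ∀ l k, V l →ₗ[S] U k)
    (hid : ∀ k, ∑ l, g l k ∘ₗ f k l = LinearMap.id)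
    (hzero : ∀ k k', k ≠ k' → ∑ l, g l k' ∘ₗ f k l = 0) (s : Finset κ) (t : Finset ι)
    (hst : ∀ k ∈ s, ∀ k' ∈ s, ∀ l ∉ t, ¬ Function.Injective (g l k' ∘ₗ f k l)) :
    s.card ≤ t.card := by
  classical
  -- On a vector killed by all the paths avoiding `t`, the paths through `t` add up to the identity.
  have : ∀ k, ∃ u : U k, k ∈ s → u ≠ 0 ∧ ∀ k' ∈ s, ∀ l ∉ t, g l k' (f k l u) = 0 := by
    intro k
    by_cases hk : k ∈ s
    swap
    · exact ⟨0, fun h => absurd h hk⟩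
    have := (hU k).finset_inf_ne_bot (s ×ˢ tᶜ)
      (fun q => LinearMap.ker (g q.2 q.1 ∘ₗ f k q.2)) ?_
    · obtain ⟨u, hu, hu0⟩ := Submodule.exists_mem_ne_zero_of_ne_bot this
      refine ⟨u, fun _ => ⟨hu0, fun k' hk' l hl => ?_⟩⟩
      exact (Finset.inf_le (f := fun q : κ × ι => LinearMap.ker (g q.2 q.1 ∘ₗ f k q.2))
        (b := (k', l)) (by simp [hk', hl])) hu
    · rintro ⟨k', l⟩ hq
      simp only [Finset.mem_product, Finset.mem_compl] at hq
      rw [Ne, LinearMap.ker_eq_bot]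
      exact hst k hk k' hq.1 l hq.2
  choose u hu using this
  have hpath : ∀ k ∈ s, ∀ k' ∈ s,
      ∑ l ∈ t, g l k' (f k l (u k)) = ∑ l, g l k' (f k l (u k)) := fun k hk k' hk' =>
    Finset.sum_subset (Finset.subset_univ _) fun l _ hl => (hu k hk).2 k' hk' l hl
  have hdiag : ∀ k ∈ s, ∑ l ∈ t, g l k (f k l (u k)) = u k := fun k hk => by
    rw [hpath k hk k hk]
    simpa using LinearMap.congr_fun (hid k) (u k)
  have hoff : ∀ k ∈ s, ∀ k' ∈ s, k ≠ k' → ∑ l ∈ t, g l k' (f k l (u k)) = 0 :=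
    fun k hk k' hk' hne => by
      rw [hpath k hk k' hk']
      simpa using LinearMap.congr_fun (hzero k k' hne) (u k)
  refine card_le_of_independent hV (fun l => LinearMap.proj l) (fun x hx => funext hx) t s
    (fun k l => if l ∈ t then f k l (u k) else 0) ?_ ?_ ?_
  · intro k hk h0
    refine (hu k hk).1 ?_
    rw [← hdiag k hk]
    refine Finset.sum_eq_zero fun l hl => ?_
    have := congrFun h0 l
    simp only [hl, if_true] at this
    rw [this]
    simp
  · intro k _ l hl
    simp [hl]
  · intro a ha k hk
    have hl : ∀ l ∈ t, ∑ j ∈ s, a j • f j l (u j) = 0 := fun l hl => by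
      have := congrFun ha l
      simpa [Finset.sum_apply, hl] using this
    have hak : a k • u k = 0 := by
      have h1 : ∑ l ∈ t, g l k (∑ j ∈ s, a j • f j l (u j)) = 0 :=
        Finset.sum_eq_zero fun l h => by rw [hl l h, map_zero]
      simp only [map_sum, map_smul] at h1
      rw [Finset.sum_comm] at h1
      simp only [← Finset.smul_sum] at h1
      rwa [Finset.sum_eq_single_of_mem k hk fun j hj hne => by rw [hoff j hj k hk hne, smul_zero],
        hdiag k hk] at h1
    funext l
    simp only [Pi.smul_apply, smul_ite, smul_zero, Pi.zero_apply]
    rw [← map_smul, hak, map_zero, ite_self]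

/-- The dual of `card_le_of_not_injective`. -/
theorem card_le_of_not_surjective [∀ k, Nontrivial (U k)] (hU : ∀ k, IsUniserialModule S (U k))
    (hV : ∀ l, IsUniserialModule S (V l)) (f : ∀ k l, U k →ₗ[S] V l) (g : ∀ l k, V l →ₗ[S] U k)
    (hid : ∀ k, ∑ l, g l k ∘ₗ f k l = LinearMap.id)
    (hzero : ∀ k k', k ≠ k' → ∑ l, g l k' ∘ₗ f k l = 0) (s : Finset κ) (t : Finset ι)
    (hst : ∀ k ∈ s, ∀ k' ∈ s, ∀ l ∉ t, ¬ Function.Surjective (g l k' ∘ₗ f k l)) :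
    s.card ≤ t.card := by
  classical
  -- Modulo the images of the paths avoiding `t`, the paths through `t` add up to the identity.
  let I : ∀ k, Submodule S (U k) := fun k =>
    (s ×ˢ tᶜ).sup fun q => LinearMap.range (g q.2 k ∘ₗ f q.1 q.2)
  have hI : ∀ k ∈ s, I k ≠ ⊤ := by
    intro k hk
    refine (hU k).finset_sup_ne_top _ _ ?_
    rintro ⟨k', l⟩ hq
    simp only [Finset.mem_product, Finset.mem_compl] at hq
    rw [Ne, LinearMap.range_eq_top]
    exact hst k' hq.1 k hk l hq.2
  have hmem : ∀ k' ∈ s, ∀ k ∈ s, ∀ u : U k',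
      ∑ l, g l k (f k' l u) - ∑ l ∈ t, g l k (f k' l u) ∈ I k := by
    intro k' hk' k _ u
    rw [← Finset.sum_add_sum_compl t, add_sub_cancel_left]
    refine sum_mem fun l hl => ?_
    exact (Finset.le_sup (f := fun q : κ × ι => LinearMap.range (g q.2 k ∘ₗ f q.1 q.2))
      (b := (k', l)) (by simpa [hk'] using hl)) ⟨u, rfl⟩
  have hdiag : ∀ k ∈ s, ∀ u : U k, ∑ l ∈ t, g l k (f k l u) - u ∈ I k := fun k hk u => by
    have := hmem k hk k hk u
    have h1 : ∑ l, g l k (f k l u) = u := by simpa using LinearMap.congr_fun (hid k) u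
    rw [h1] at this
    simpa using neg_mem this
  have hoff : ∀ k' ∈ s, ∀ k ∈ s, k' ≠ k → ∀ u : U k', ∑ l ∈ t, g l k (f k' l u) ∈ I k :=
    fun k' hk' k hk hne u => by
      have := hmem k' hk' k hk u
      have h1 : ∑ l, g l k (f k' l u) = 0 := by simpa using LinearMap.congr_fun (hzero k' k hne) u
      rw [h1] at this
      simpa using neg_mem this
  let G : ∀ k, (∀ l, V l) →ₗ[S] U k := fun k => ∑ l ∈ t, g l k ∘ₗ LinearMap.proj l
  have hG : ∀ k x, G k x = ∑ l ∈ t, g l k (x l) := fun k x => by simp [G]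
  refine card_le_of_coindependent (fun l => LinearMap.range (LinearMap.single S V l)) ?_ ?_ t s
    (fun k => (I k).comap (G k)) ?_ ?_ ?_
  · intro l A B hA hB
    rw [← Submodule.map_comap_eq_of_le hA, ← Submodule.map_comap_eq_of_le hB]
    rcases hV l (A.comap (LinearMap.single S V l)) (B.comap (LinearMap.single S V l)) with h | h
    · exact .inl (Submodule.map_mono h)
    · exact .inr (Submodule.map_mono h)
  · exact LinearMap.iSup_range_single S V
  · intro k hk h
    refine hI k hk (eq_top_iff.2 fun u _ => ?_)
    have h1 : (fun l => f k l u) ∈ (I k).comap (G k) := h ▸ Submodule.mem_top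
    rw [Submodule.mem_comap, hG] at h1
    simpa using sub_mem h1 (hdiag k hk u)
  · rintro k _ l hl _ ⟨v, rfl⟩
    rw [Submodule.mem_comap, hG, Finset.sum_eq_zero]
    · exact zero_mem _
    · intro j hj
      have : j ≠ l := fun h => hl (h ▸ hj)
      simp [this]
  · intro y
    refine ⟨∑ j ∈ s, fun l => f j l (G j (y j)), fun k hk => ?_⟩
    rw [Submodule.mem_comap, map_sub, map_sum, ← Finset.add_sum_erase _ _ hk, add_sub_right_comm]
    refine add_mem ?_ (sum_mem fun j hj => ?_)
    · rw [hG k fun l => _]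
      exact hdiag k hk _
    · rw [hG k fun l => _]
      exact hoff j (Finset.mem_of_mem_erase hj) k hk (Finset.ne_of_mem_erase hj) _

end GoldieDimension

/-! ### Completely prime ideals of a preadditive category -/

section CompletelyPrime

open CategoryTheory.Limits

variable {C : Type*} [Category C] [Preadditive C] {I : Type*}

/-- A completely prime ideal of the full subcategory of a preadditive category on a family of
objects: subgroups `hom i j` of the morphism groups, such that a composite lies in the ideal
exactly when one of its factors does, and which contain no identity. -/
structure CompletelyPrimeIdeal (obj : I → C) where
  hom : ∀ i j, AddSubgroup (obj i ⟶ obj j)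
  comp_mem_iff : ∀ {i j k} (f : obj i ⟶ obj j) (g : obj j ⟶ obj k),
    f ≫ g ∈ hom i k ↔ f ∈ hom i j ∨ g ∈ hom j k
  id_notMem : ∀ i, 𝟙 (obj i) ∉ hom i i

namespace CompletelyPrimeIdeal

variable {obj : I → C}

/-- Two objects are in the same class modulo a completely prime ideal if there are morphisms in
both directions outside the ideal. -/
def Related (P : CompletelyPrimeIdeal obj) (i j : I) : Prop :=
  ∃ (f : obj i ⟶ obj j) (g : obj j ⟶ obj i), f ∉ P.hom i j ∧ g ∉ P.hom j i

theorem Related.symm {P : CompletelyPrimeIdeal obj} {i j : I} : P.Related i j → P.Related j i :=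
  fun ⟨f, g, hf, hg⟩ => ⟨g, f, hg, hf⟩

theorem notMem_of_sub_id_mem (P : CompletelyPrimeIdeal obj) {i : I} {f : obj i ⟶ obj i}
    (h : f - 𝟙 _ ∈ P.hom i i) : f ∉ P.hom i i := fun hf =>
  P.id_notMem i (by simpa using sub_mem hf h)

/-- An inverse modulo a completely prime ideal on one side is an inverse on the other side. -/
theorem comp_sub_id_mem_symm (P : CompletelyPrimeIdeal obj) {i j : I} {f : obj i ⟶ obj j}
    {g : obj j ⟶ obj i} (h : f ≫ g - 𝟙 _ ∈ P.hom i i) : g ≫ f - 𝟙 _ ∈ P.hom j j := by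
  have hfg := P.notMem_of_sub_id_mem h
  rw [P.comp_mem_iff, not_or] at hfg
  have h1 : (g ≫ f) ≫ (g ≫ f - 𝟙 _) ∈ P.hom j j := by
    have : (g ≫ f) ≫ (g ≫ f - 𝟙 _) = (g ≫ (f ≫ g - 𝟙 _)) ≫ f := by simp
    rw [this, P.comp_mem_iff, P.comp_mem_iff]
    exact .inl (.inr h)
  rw [P.comp_mem_iff, P.comp_mem_iff] at h1
  tauto

variable {T : Type*} [LinearOrder T] (P : T → CompletelyPrimeIdeal obj)

/-- The ideal with label `t` restricts to a maximal element among the ideals of the endomorphism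
ring of the `i`-th object coming from the family `P`, and `t` is the least of its labels. Every
such maximal element has exactly one dominant label. -/
def Dominant (t : T) (i : I) : Prop :=
  ∀ t', t' ≠ t → (P t).hom i i ≤ (P t').hom i i → t < t' ∧ (P t').hom i i ≤ (P t).hom i i

variable {P}

theorem Dominant.not_le {t t' : T} {i : I} (h : Dominant P t i) (h' : Dominant P t' i)
    (hne : t' ≠ t) : ¬ (P t').hom i i ≤ (P t).hom i i := fun hle =>
  have h1 := h' t hne.symm hle
  lt_asymm h1.1 (h t' hne h1.2).1

variable [Finite T]

variable (P) in
theorem exists_dominant (t : T) (i : I) :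
    ∃ t', Dominant P t' i ∧ (P t).hom i i ≤ (P t').hom i i := by
  obtain ⟨t₁, ht₁, hmax⟩ := Set.Finite.exists_maximalFor (fun t' => (P t').hom i i)
    {t' | (P t).hom i i ≤ (P t').hom i i} (Set.toFinite _)
    ⟨t, le_refl ((P t).hom i i)⟩
  obtain ⟨t₂, ht₂, hmin⟩ := Set.Finite.exists_minimalFor id
    {t' | (P t').hom i i = (P t₁).hom i i} (Set.toFinite _) ⟨t₁, rfl⟩
  simp only [Set.mem_ofPred_eq, id] at *
  refine ⟨t₂, fun t' hne hle => ?_, ht₂ ▸ ht₁⟩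
  rw [ht₂] at hle ⊢
  have hle' := hmax (ht₁.trans hle) hle
  exact ⟨lt_of_le_of_ne (le_of_not_ge fun h => hne (le_antisymm h (hmin (le_antisymm hle' hle) h)))
    hne.symm, hle'⟩

/-- Dominant ideals are separated by a single endomorphism, since a completely prime ideal that
contains none of finitely many ideals does not contain their product. -/
theorem Dominant.exists_separating {t : T} {i : I} (h : Dominant P t i) :
    ∃ e : obj i ⟶ obj i, e ∉ (P t).hom i i ∧
      ∀ t', t' ≠ t → Dominant P t' i → e ∈ (P t').hom i i := by
  classical
  cases nonempty_fintype T
  suffices H : ∀ s : Finset T, ∃ e : obj i ⟶ obj i, e ∉ (P t).hom i i ∧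
      ∀ t' ∈ s, t' ≠ t → Dominant P t' i → e ∈ (P t').hom i i by
    obtain ⟨e, he, he'⟩ := H Finset.univ
    exact ⟨e, he, fun t' => he' t' (Finset.mem_univ _)⟩
  intro s
  induction s using Finset.induction_on with
  | empty => exact ⟨𝟙 _, (P t).id_notMem i, by simp⟩
  | insert a s _ ih =>
    obtain ⟨e, he, hes⟩ := ih
    by_cases ha : a ≠ t ∧ Dominant P a i
    · obtain ⟨d, hd, hd'⟩ := SetLike.not_le_iff_exists.1 (h.not_le ha.2 ha.1)
      refine ⟨d ≫ e, by rw [(P t).comp_mem_iff]; tauto, fun t' ht' hne hdom => ?_⟩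
      rw [(P t').comp_mem_iff]
      rcases Finset.mem_insert.1 ht' with rfl | ht'
      · exact .inl hd
      · exact .inr (hes t' ht' hne hdom)
    · refine ⟨e, he, fun t' ht' hne hdom => ?_⟩
      rcases Finset.mem_insert.1 ht' with rfl | ht'
      · exact absurd ⟨hne, hdom⟩ ha
      · exact hes t' ht' hne hdom

theorem isIso_of_notMem_dominant
    (hiso : ∀ i (f : obj i ⟶ obj i), (∀ t, f ∉ (P t).hom i i) → IsIso f) {i : I}
    {f : obj i ⟶ obj i} (hf : ∀ t, Dominant P t i → f ∉ (P t).hom i i) : IsIso f :=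
  hiso i f fun t h => by
    obtain ⟨t', hdom, hle⟩ := exists_dominant P t i
    exact hf t' hdom (hle h)

/-- The endomorphisms modulo a dominant ideal form a division ring. -/
theorem Dominant.exists_inverse
    (hiso : ∀ i (f : obj i ⟶ obj i), (∀ t, f ∉ (P t).hom i i) → IsIso f) {t : T} {i : I}
    (ht : Dominant P t i) {h : obj i ⟶ obj i} (hh : h ∉ (P t).hom i i) :
    ∃ u : obj i ⟶ obj i, h ≫ u - 𝟙 _ ∈ (P t).hom i i := by
  classical
  cases nonempty_fintype T
  choose e he he' using fun (t : T) (ht : Dominant P t i) => ht.exists_separating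
  -- Adding to `h` an element of the ideals missing `h` produces an automorphism.
  let q : T → (obj i ⟶ obj i) := fun t' =>
    if ht' : Dominant P t' i ∧ h ∈ (P t').hom i i then e t' ht'.1 else 0
  have hq : ∀ t₁ t₂, t₁ ≠ t₂ → Dominant P t₂ i → q t₁ ∈ (P t₂).hom i i := fun t₁ t₂ hne h₂ => by
    by_cases h₁ : Dominant P t₁ i ∧ h ∈ (P t₁).hom i i
    · simp only [q, dif_pos h₁]
      exact he' t₁ h₁.1 t₂ hne.symm h₂
    · simp only [q, dif_neg h₁]
      exact zero_mem _
  have hq0 : ∀ t', h ∉ (P t').hom i i → q t' = 0 := fun t' h' => dif_neg fun h'' => h' h''.2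
  have hunit : IsIso (h + ∑ t', q t') := by
    refine isIso_of_notMem_dominant hiso fun t' ht' hmem => ?_
    rw [← Finset.add_sum_erase _ _ (Finset.mem_univ t'), ← add_assoc] at hmem
    have h1 := (AddSubgroup.add_mem_cancel_right _ (sum_mem fun t'' ht'' =>
      hq t'' t' (Finset.ne_of_mem_erase ht'') ht')).1 hmem
    by_cases h2 : h ∈ (P t').hom i i
    · rw [AddSubgroup.add_mem_cancel_left _ h2] at h1
      simp only [q, dif_pos (⟨ht', h2⟩ : Dominant P t' i ∧ h ∈ (P t').hom i i)] at h1
      exact he t' ht' h1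
    · rw [hq0 t' h2, add_zero] at h1
      exact h2 h1
  refine ⟨inv (h + ∑ t', q t'), ?_⟩
  have h1 : h ≫ inv (h + ∑ t', q t') - 𝟙 _ = (-∑ t', q t') ≫ inv (h + ∑ t', q t') := by
    rw [← IsIso.hom_inv_id (h + ∑ t', q t'), ← Preadditive.sub_comp]
    simp
  rw [h1, (P t).comp_mem_iff]
  refine .inl (neg_mem (sum_mem fun t' _ => ?_))
  by_cases hne : t' = t
  · subst hne
    rw [hq0 t' hh]
    exact zero_mem _
  · exact hq t' t hne ht

theorem Dominant.exists_comp_sub_id_mem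
    (hiso : ∀ i (f : obj i ⟶ obj i), (∀ t, f ∉ (P t).hom i i) → IsIso f) {t : T} {i j : I}
    (ht : Dominant P t i) {f : obj i ⟶ obj j} {g : obj j ⟶ obj i} (hf : f ∉ (P t).hom i j)
    (hg : g ∉ (P t).hom j i) : ∃ u : obj i ⟶ obj i, f ≫ g ≫ u - 𝟙 _ ∈ (P t).hom i i := by
  obtain ⟨u, hu⟩ := ht.exists_inverse hiso (h := f ≫ g) (by rw [(P t).comp_mem_iff]; tauto)
  exact ⟨u, by simpa using hu⟩

/-- Transport of ideals along `f` and `g` shows that being dominant depends on the class only. -/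
theorem Dominant.of_related
    (hiso : ∀ i (f : obj i ⟶ obj i), (∀ t, f ∉ (P t).hom i i) → IsIso f) {t : T} {i j : I}
    (ht : Dominant P t i) (hij : (P t).Related i j) : Dominant P t j := by
  obtain ⟨f, g₀, hf, hg₀⟩ := hij
  obtain ⟨u, hu⟩ := ht.exists_comp_sub_id_mem hiso hf hg₀
  set g := g₀ ≫ u
  have hfg := (P t).notMem_of_sub_id_mem hu
  have hgf := (P t).comp_sub_id_mem_symm hu
  intro t' hne hle
  have hgf' := (P t').notMem_of_sub_id_mem (hle hgf)
  rw [(P t').comp_mem_iff, not_or] at hgf'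
  rw [(P t).comp_mem_iff, not_or] at hfg
  have h1 := ht t' hne fun h hh => by
    have : g ≫ h ≫ f ∈ (P t').hom j j := hle (by simp only [(P t).comp_mem_iff]; tauto)
    simp only [(P t').comp_mem_iff] at this
    tauto
  refine ⟨h1.1, fun h hh => ?_⟩
  have : f ≫ h ≫ g ∈ (P t).hom i i := h1.2 (by simp only [(P t').comp_mem_iff]; tauto)
  simp only [(P t).comp_mem_iff] at this
  tauto

/-- Mutually inverse morphisms modulo a dominant ideal that vanish modulo the other ones. -/
theorem Dominant.exists_inverse_pair
    (hiso : ∀ i (f : obj i ⟶ obj i), (∀ t, f ∉ (P t).hom i i) → IsIso f) {t : T} {i j : I}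
    (ht : Dominant P t i) (hij : (P t).Related i j) :
    ∃ (f : obj i ⟶ obj j) (g : obj j ⟶ obj i),
      f ≫ g - 𝟙 _ ∈ (P t).hom i i ∧ g ≫ f - 𝟙 _ ∈ (P t).hom j j ∧
      ∀ t', t' ≠ t → Dominant P t' i ∨ Dominant P t' j →
        f ∈ (P t').hom i j ∧ g ∈ (P t').hom j i := by
  obtain ⟨d, hd, hd'⟩ := ht.exists_separating
  obtain ⟨e, he, he'⟩ := (ht.of_related hiso hij).exists_separating
  obtain ⟨f, g, hf, hg⟩ := hij
  obtain ⟨u, hu⟩ := ht.exists_comp_sub_id_mem hiso (f := d ≫ f ≫ e) (g := e ≫ g ≫ d)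
    (by simp only [(P t).comp_mem_iff]; tauto) (by simp only [(P t).comp_mem_iff]; tauto)
  refine ⟨d ≫ f ≫ e, (e ≫ g ≫ d) ≫ u, hu, (P t).comp_sub_id_mem_symm hu, fun t' hne h => ?_⟩
  have h1 := hd' t' hne
  have h2 := he' t' hne
  simp only [(P t').comp_mem_iff]
  tauto

end CompletelyPrimeIdeal

/-! ### Isomorphisms between direct sums modulo the radical -/

/-- Invertibility of `1 - ab` and `1 - ba` are equivalent. -/
theorem CategoryTheory.Preadditive.isIso_id_sub_comp_comm {X Y : C} (a : X ⟶ Y) (b : Y ⟶ X)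
    [IsIso (𝟙 X - a ≫ b)] : IsIso (𝟙 Y - b ≫ a) := by
  have h1 : a ≫ b ≫ inv (𝟙 X - a ≫ b) = inv (𝟙 X - a ≫ b) - 𝟙 X := by
    have := IsIso.hom_inv_id (𝟙 X - a ≫ b)
    rw [Preadditive.sub_comp, Category.id_comp, Category.assoc] at this
    exact (sub_sub_cancel _ _).symm.trans (congrArg (_ - ·) this)
  have h2 : inv (𝟙 X - a ≫ b) ≫ a ≫ b = inv (𝟙 X - a ≫ b) - 𝟙 X := by
    have := IsIso.inv_hom_id (𝟙 X - a ≫ b)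
    rw [Preadditive.comp_sub, Category.comp_id] at this
    exact (sub_sub_cancel _ _).symm.trans (congrArg (_ - ·) this)
  refine ⟨𝟙 Y + b ≫ inv (𝟙 X - a ≫ b) ≫ a, ?_, ?_⟩
  · simp only [Preadditive.sub_comp, Preadditive.comp_add, Category.id_comp, Category.comp_id,
      Category.assoc]
    rw [reassoc_of% h1]
    simp
  · simp only [Preadditive.comp_sub, Preadditive.add_comp, Category.id_comp, Category.comp_id,
      Category.assoc]
    rw [reassoc_of% h2]
    simp

/-- The set of `x` such that `1 - zx` is invertible for all `z`, the Jacobson radical, is closed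
under finite sums. -/
theorem CategoryTheory.Preadditive.isIso_id_sub_comp_sum {X : C} {ι : Type*} (s : Finset ι)
    (x : ι → (X ⟶ X)) (hx : ∀ i ∈ s, ∀ z : X ⟶ X, IsIso (𝟙 X - z ≫ x i)) (z : X ⟶ X) :
    IsIso (𝟙 X - z ≫ ∑ i ∈ s, x i) := by
  classical
  induction s using Finset.induction_on generalizing z with
  | empty =>
    simp only [Finset.sum_empty, comp_zero, sub_zero]
    infer_instance
  | insert a s ha ih =>
    rw [Finset.sum_insert ha]
    have h1 := hx a (Finset.mem_insert_self a s) z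
    have h2 := ih (fun i hi => hx i (Finset.mem_insert_of_mem hi)) (inv (𝟙 X - z ≫ x a) ≫ z)
    have : 𝟙 X - z ≫ (x a + ∑ i ∈ s, x i) =
        (𝟙 X - z ≫ x a) ≫ (𝟙 X - (inv (𝟙 X - z ≫ x a) ≫ z) ≫ ∑ i ∈ s, x i) := by
      rw [Preadditive.comp_sub]
      simp only [Category.assoc, IsIso.hom_inv_id_assoc, Category.comp_id, Preadditive.comp_add]
      abel
    rw [this]
    infer_instance

namespace CompletelyPrimeIdeal

variable {obj : I → C} {T : Type*} [Finite T] [LinearOrder T] {P : T → CompletelyPrimeIdeal obj}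
  {κ ι : Type*} [Fintype κ] [Fintype ι] {M : κ → I} {N : ι → I}

/-- An endomorphism of a direct sum is invertible if the entries of its matrix agree with those of
the identity modulo the dominant ideals of their targets. -/
theorem isIso_of_entries_mem
    (hiso : ∀ i (f : obj i ⟶ obj i), (∀ t, f ∉ (P t).hom i i) → IsIso f)
    (b : Bicone fun k => obj (M k)) (hb : ∑ k, b.π k ≫ b.ι k = 𝟙 b.pt) (x : b.pt ⟶ b.pt)
    (hx : ∀ k k' t, Dominant P t (M k') →
      b.ι k ≫ (𝟙 _ - x) ≫ b.π k' ∈ (P t).hom (M k) (M k')) : IsIso x := by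
  set y := 𝟙 _ - x with hy
  have hsum : y = ∑ q : κ × κ, b.π q.1 ≫ (b.ι q.1 ≫ y ≫ b.π q.2) ≫ b.ι q.2 := by
    have h1 : y = (∑ k, b.π k ≫ b.ι k) ≫ y ≫ ∑ k, b.π k ≫ b.ι k := by simp [hb]
    rw [Fintype.sum_prod_type]
    conv_lhs => rw [h1]
    simp only [Preadditive.sum_comp, Preadditive.comp_sum, Category.assoc]
    exact Finset.sum_comm
  have hx' : x = 𝟙 _ - 𝟙 _ ≫ ∑ q : κ × κ, b.π q.1 ≫ (b.ι q.1 ≫ y ≫ b.π q.2) ≫ b.ι q.2 := by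
    rw [← hsum, hy]
    simp
  rw [hx']
  refine Preadditive.isIso_id_sub_comp_sum _ _ (fun q _ z => ?_) _
  have : IsIso (𝟙 (obj (M q.2)) - b.ι q.2 ≫ (z ≫ b.π q.1 ≫ (b.ι q.1 ≫ y ≫ b.π q.2))) := by
    refine isIso_of_notMem_dominant hiso fun t ht hmem => (P t).id_notMem (M q.2) ?_
    have h1 : b.ι q.2 ≫ z ≫ b.π q.1 ≫ b.ι q.1 ≫ y ≫ b.π q.2 ∈ (P t).hom (M q.2) (M q.2) := by
      have := ((P t).comp_mem_iff (b.ι q.2 ≫ z ≫ b.π q.1) (b.ι q.1 ≫ y ≫ b.π q.2)).2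
        (.inr (hx q.1 q.2 t ht))
      simpa only [Category.assoc] using this
    have := add_mem hmem h1
    rwa [sub_add_cancel] at this
  have := Preadditive.isIso_id_sub_comp_comm (b.ι q.2) (z ≫ b.π q.1 ≫ (b.ι q.1 ≫ y ≫ b.π q.2))
  simpa only [Category.assoc] using this

end CompletelyPrimeIdeal

section Matrix

variable {κ ι ι' : Type*} [Fintype κ] [Fintype ι] {X : κ → C} {Y : ι → C} {Z : ι' → C}

/-- The morphism of direct sums given by a matrix. -/
noncomputable def CategoryTheory.Limits.Bicone.matrix (b : Bicone X) (c : Bicone Y)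
    (f : ∀ k l, X k ⟶ Y l) : b.pt ⟶ c.pt :=
  ∑ k, ∑ l, b.π k ≫ f k l ≫ c.ι l

theorem CategoryTheory.Limits.Bicone.ι_matrix (b : Bicone X) (c : Bicone Y)
    (f : ∀ k l, X k ⟶ Y l) (k : κ) : b.ι k ≫ b.matrix c f = ∑ l, f k l ≫ c.ι l := by
  classical
  rw [matrix, Preadditive.comp_sum, Finset.sum_eq_single_of_mem k (Finset.mem_univ k)]
  · rw [Preadditive.comp_sum]
    exact Finset.sum_congr rfl fun l _ => bicone_ι_π_self_assoc b k _
  · intro k' _ hne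
    rw [Preadditive.comp_sum]
    exact Finset.sum_eq_zero fun l _ => by
      rw [← Category.assoc, bicone_ι_π_ne b hne.symm, zero_comp]

theorem CategoryTheory.Limits.Bicone.ι_matrix_π (b : Bicone X) (c : Bicone Y)
    (f : ∀ k l, X k ⟶ Y l) (k : κ) (l : ι) : b.ι k ≫ b.matrix c f ≫ c.π l = f k l := by
  classical
  rw [← Category.assoc, ι_matrix, Preadditive.sum_comp,
    Finset.sum_eq_single_of_mem l (Finset.mem_univ l)]
  · simp
  · intro l' _ hne
    rw [Category.assoc, bicone_ι_π_ne c hne, comp_zero]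

theorem CategoryTheory.Limits.Bicone.ι_matrix_comp_matrix_π [Fintype ι'] (b : Bicone X)
    (c : Bicone Y) (d : Bicone Z) (f : ∀ k l, X k ⟶ Y l) (g : ∀ l m, Y l ⟶ Z m) (k : κ) (m : ι') :
    b.ι k ≫ (b.matrix c f ≫ c.matrix d g) ≫ d.π m = ∑ l, f k l ≫ g l m := by
  rw [Category.assoc, ← Category.assoc, ι_matrix, Preadditive.sum_comp]
  exact Finset.sum_congr rfl fun l _ => by rw [Category.assoc, ι_matrix_π]

end Matrix

namespace CompletelyPrimeIdeal

variable {obj : I → C} {T : Type*} [Fintype T] [LinearOrder T] {P : T → CompletelyPrimeIdeal obj}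
  {κ ι : Type*} [Fintype κ] [Fintype ι] {M : κ → I} {N : ι → I}

/-- The composite of the matrices `∑ t, f t` and `∑ t, g t` is invertible if, for dominant labels
`t`, the matrices `f t` and `g t` are monomial, their non-zero entries are mutually inverse modulo
the ideal `P t`, and the other matrices `f t'` and `g t'` vanish modulo `P t`. -/
theorem isIso_matrix_comp_matrix
    (hiso : ∀ i (f : obj i ⟶ obj i), (∀ t, f ∉ (P t).hom i i) → IsIso f)
    (b : Bicone fun k => obj (M k)) (c : Bicone fun l => obj (N l))
    (hb : ∑ k, b.π k ≫ b.ι k = 𝟙 b.pt) (σ : T → κ ≃ ι)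
    (f : ∀ (_ : T) (k : κ) (l : ι), obj (M k) ⟶ obj (N l))
    (g : ∀ (_ : T) (l : ι) (k : κ), obj (N l) ⟶ obj (M k))
    (hσ : ∀ t k, Dominant P t (M k) → Dominant P t (N (σ t k)))
    (hinv : ∀ t k, Dominant P t (M k) →
      f t k (σ t k) ≫ g t (σ t k) k - 𝟙 _ ∈ (P t).hom (M k) (M k))
    (hf : ∀ t k l t', t' ≠ t → Dominant P t' (N l) → f t k l ∈ (P t').hom (M k) (N l))
    (hg : ∀ t k l t', t' ≠ t → Dominant P t' (M k) → g t l k ∈ (P t').hom (N l) (M k))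
    (hzf : ∀ t k l, σ t k ≠ l → f t k l = 0) (hzg : ∀ t k l, σ t k ≠ l → g t l k = 0) :
    IsIso (b.matrix c (fun k l => ∑ t, f t k l) ≫ c.matrix b (fun l k => ∑ t, g t l k)) := by
  classical
  refine isIso_of_entries_mem hiso b hb _ fun k k' t ht => ?_
  rw [Preadditive.sub_comp, Preadditive.comp_sub, Category.id_comp, Bicone.ι_matrix_comp_matrix_π]
  -- Modulo `P t`, only the matrices `f t` and `g t` contribute.
  have h1 : ∑ l, (∑ t, f t k l) ≫ (∑ t, g t l k') - ∑ l, f t k l ≫ g t l k' ∈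
      (P t).hom (M k) (M k') := by
    rw [← Finset.sum_sub_distrib]
    refine sum_mem fun l _ => ?_
    rw [← Finset.add_sum_erase _ (fun t => g t l k') (Finset.mem_univ t), Preadditive.comp_add,
      add_sub_right_comm, ← Preadditive.sub_comp]
    refine add_mem ?_ (((P t).comp_mem_iff _ _).2 (.inr (sum_mem fun t' ht' =>
      hg t' k' l t (Finset.ne_of_mem_erase ht').symm ht)))
    by_cases hl : σ t k' = l
    · refine ((P t).comp_mem_iff _ _).2 (.inl ?_)
      rw [← Finset.add_sum_erase _ (fun t => f t k l) (Finset.mem_univ t), add_sub_cancel_left]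
      exact sum_mem fun t' ht' =>
        hf t' k l t (Finset.ne_of_mem_erase ht').symm (hl ▸ hσ t k' ht)
    · rw [hzg t k' l hl, comp_zero]
      exact zero_mem _
  have h2 : b.ι k ≫ b.π k' - ∑ l, f t k l ≫ g t l k' ∈ (P t).hom (M k) (M k') := by
    by_cases hk : k = k'
    · subst hk
      rw [Finset.sum_eq_single_of_mem (σ t k) (Finset.mem_univ _), bicone_ι_π_self,
        ← neg_sub]
      · exact neg_mem (hinv t k ht)
      · intro l _ hl
        rw [hzg t k l hl.symm, comp_zero]
    · rw [bicone_ι_π_ne b hk, Finset.sum_eq_zero, sub_zero]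
      · exact zero_mem _
      · intro l _
        by_cases hl : σ t k' = l
        · rw [hzf t k l fun h => hk ((σ t).injective (h.trans hl.symm)), zero_comp]
        · rw [hzg t k' l hl, comp_zero]
  simpa using sub_mem h2 h1

end CompletelyPrimeIdeal

/-- **Sufficiency.** Suppose that finitely many completely prime ideals detect the automorphisms of
the objects `obj i`. Two direct sums of such objects are isomorphic if for every ideal there is a
bijection between the summands that preserves the classes modulo that ideal. -/
theorem CompletelyPrimeIdeal.nonempty_iso {obj : I → C} {T : Type*} [Finite T]
    (P : T → CompletelyPrimeIdeal obj)
    (hiso : ∀ i (f : obj i ⟶ obj i), (∀ t, f ∉ (P t).hom i i) → IsIso f)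
    {κ ι : Type*} [Fintype κ] [Fintype ι] {M : κ → I} {N : ι → I}
    (b : Bicone fun k => obj (M k)) (c : Bicone fun l => obj (N l))
    (hb : ∑ k, b.π k ≫ b.ι k = 𝟙 b.pt) (hc : ∑ l, c.π l ≫ c.ι l = 𝟙 c.pt)
    (σ : T → κ ≃ ι) (hσ : ∀ t k, (P t).Related (M k) (N (σ t k))) : Nonempty (b.pt ≅ c.pt) := by
  classical
  cases nonempty_fintype T
  let _ : LinearOrder T := LinearOrder.lift' (Fintype.equivFin T) (Fintype.equivFin T).injective
  have hdom : ∀ t k, Dominant P t (M k) ↔ Dominant P t (N (σ t k)) := fun t k =>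
    ⟨fun h => h.of_related hiso (hσ t k), fun h => h.of_related hiso (hσ t k).symm⟩
  have key : ∀ t k l, ∃ (f : obj (M k) ⟶ obj (N l)) (g : obj (N l) ⟶ obj (M k)),
      (Dominant P t (M k) → σ t k = l →
        f ≫ g - 𝟙 _ ∈ (P t).hom (M k) (M k) ∧ g ≫ f - 𝟙 _ ∈ (P t).hom (N l) (N l)) ∧
      (∀ t', t' ≠ t → Dominant P t' (M k) ∨ Dominant P t' (N l) →
        f ∈ (P t').hom (M k) (N l) ∧ g ∈ (P t').hom (N l) (M k)) ∧
      (σ t k ≠ l → f = 0 ∧ g = 0) := by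
    intro t k l
    by_cases h : Dominant P t (M k) ∧ σ t k = l
    · obtain ⟨hd, rfl⟩ := h
      obtain ⟨f, g, h1, h2, h3⟩ := hd.exists_inverse_pair hiso (hσ t k)
      exact ⟨f, g, fun _ _ => ⟨h1, h2⟩, h3, fun h => absurd rfl h⟩
    · exact ⟨0, 0, fun h1 h2 => absurd ⟨h1, h2⟩ h, fun _ _ _ => ⟨zero_mem _, zero_mem _⟩,
        fun _ => ⟨rfl, rfl⟩⟩
  choose f g hinv hvan hzero using key
  have h1 := isIso_matrix_comp_matrix hiso b c hb σ f (fun t l k => g t k l)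
    (fun t k => (hdom t k).1) (fun t k h => (hinv t k _ h rfl).1)
    (fun t k l t' hne h => (hvan t k l t' hne (.inr h)).1)
    (fun t k l t' hne h => (hvan t k l t' hne (.inl h)).2)
    (fun t k l h => (hzero t k l h).1) (fun t k l h => (hzero t k l h).2)
  have h2 := isIso_matrix_comp_matrix hiso c b hc (fun t => (σ t).symm) (fun t l k => g t k l) f
    (fun t l h => (hdom t _).2 (by simpa using h))
    (fun t l h => (hinv t _ l ((hdom t _).2 (by simpa using h)) (by simp)).2)
    (fun t l k t' hne h => (hvan t k l t' hne (.inl h)).2)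
    (fun t l k t' hne h => (hvan t k l t' hne (.inr h)).1)
    (fun t l k h => (hzero t k l fun h' => h (by simp [← h'])).2)
    (fun t l k h => (hzero t k l fun h' => h (by simp [← h'])).1)
  set F := b.matrix c fun k l => ∑ t, f t k l
  set G := c.matrix b fun l k => ∑ t, g t k l
  -- `F` has a right inverse because `FG` is invertible and a left inverse because `GF` is.
  have : IsSplitMono F := ⟨⟨⟨G ≫ inv (F ≫ G), by rw [← Category.assoc, IsIso.hom_inv_id]⟩⟩⟩
  have : IsSplitEpi F := ⟨⟨⟨inv (G ≫ F) ≫ G, by rw [Category.assoc, IsIso.inv_hom_id]⟩⟩⟩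
  have : IsIso F := isIso_of_mono_of_isSplitEpi F
  exact ⟨asIso F⟩

end CompletelyPrime

/-! ### Matching by fibres -/

/-- Two maps with finite domains whose fibres have the same cardinality differ by a bijection. -/
theorem exists_equiv_of_card_fiber_eq {α β γ : Type*} [Fintype α] [Fintype β] [DecidableEq γ]
    (p : α → γ) (q : β → γ)
    (h : ∀ c, (Finset.univ.filter (p · = c)).card = (Finset.univ.filter (q · = c)).card) :
    ∃ e : α ≃ β, ∀ a, q (e a) = p a :=
  ⟨Equiv.ofFiberEquiv fun c => Fintype.equivOfCardEq
    (by rw [Fintype.card_subtype, Fintype.card_subtype, h c]), fun a => Equiv.ofFiberEquiv_map _ a⟩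

/-! ### The additive category of modules with a chain of submodules -/

namespace ChainModule

variable {S : Type u} [Ring S] {n : ℕ}

@[ext]
theorem hom_ext {M N : ChainModule.{u, v} S n} {f g : M ⟶ N}
    (h : ∀ x, Hom.toLin f x = Hom.toLin g x) : f = g :=
  Hom.ext (LinearMap.ext h)

@[simp]
theorem toLin_comp {L M N : ChainModule.{u, v} S n} (f : L ⟶ M) (g : M ⟶ N) :
    Hom.toLin (f ≫ g) = Hom.toLin g ∘ₗ Hom.toLin f := rfl

/-- The linear maps underlying the morphisms of chains form a subgroup of all linear maps. -/
def homSubgroup (M N : ChainModule.{u, v} S n) : AddSubgroup (M.carrier →ₗ[S] N.carrier) where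
  carrier := {f | ∀ (j : Fin (n + 1)) (x : M.carrier), x ∈ M.sub j → f x ∈ N.sub j}
  zero_mem' _ _ _ := zero_mem _
  add_mem' hf hg j x hx := add_mem (hf j x hx) (hg j x hx)
  neg_mem' hf j x hx := neg_mem (hf j x hx)

/-- Morphisms of chains as elements of the subgroup `homSubgroup`. -/
def homEquiv (M N : ChainModule.{u, v} S n) : (M ⟶ N) ≃ homSubgroup M N where
  toFun f := ⟨Hom.toLin f, Hom.map_sub f⟩
  invFun f := ⟨f.1, f.2⟩
  left_inv _ := rfl
  right_inv _ := rfl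

instance (M N : ChainModule.{u, v} S n) : AddCommGroup (M ⟶ N) := (homEquiv M N).addCommGroup

@[simp]
theorem toLin_add {M N : ChainModule.{u, v} S n} (f g : M ⟶ N) :
    Hom.toLin (f + g) = Hom.toLin f + Hom.toLin g := rfl

/-- The underlying linear map as a homomorphism of groups. -/
def toLinHom (M N : ChainModule.{u, v} S n) : (M ⟶ N) →+ (M.carrier →ₗ[S] N.carrier) where
  toFun f := Hom.toLin f
  map_zero' := rfl
  map_add' _ _ := rfl

theorem toLin_sum {M N : ChainModule.{u, v} S n} {ι : Type*} (s : Finset ι) (f : ι → (M ⟶ N)) :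
    Hom.toLin (∑ i ∈ s, f i : M ⟶ N) = ∑ i ∈ s, Hom.toLin (f i) :=
  map_sum (toLinHom M N) f s

instance : Preadditive (ChainModule.{u, v} S n) where
  add_comp _ _ _ f f' g := by ext; simp
  comp_add _ _ _ f g g' := by ext; simp

section inducedMap

variable {L M N : ChainModule.{u, v} S n} (i : Fin n)

theorem inducedMap_mk (f : M ⟶ N) (x : M.sub i.succ) :
    inducedMap f i (Submodule.Quotient.mk x) =
      Submodule.Quotient.mk ⟨Hom.toLin f x, Hom.map_sub f i.succ x x.2⟩ := rfl

theorem inducedMap_id : inducedMap (𝟙 M) i = LinearMap.id := by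
  ext x
  rfl

theorem inducedMap_comp (f : L ⟶ M) (g : M ⟶ N) :
    inducedMap (f ≫ g) i = inducedMap g i ∘ₗ inducedMap f i := by
  ext x
  rfl

theorem inducedMap_zero : inducedMap (0 : M ⟶ N) i = 0 := by
  ext x
  rfl

theorem inducedMap_add (f g : M ⟶ N) :
    inducedMap (f + g) i = inducedMap f i + inducedMap g i := by
  ext x
  rfl

theorem inducedMap_neg (f : M ⟶ N) : inducedMap (-f) i = -inducedMap f i :=
  eq_neg_of_add_eq_zero_left (by rw [← inducedMap_add, neg_add_cancel, inducedMap_zero])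

theorem inducedMap_sum {ι : Type*} (s : Finset ι) (f : ι → (M ⟶ N)) :
    inducedMap (∑ j ∈ s, f j) i = ∑ j ∈ s, inducedMap (f j) i :=
  map_sum (AddMonoidHom.mk' (fun f : M ⟶ N => inducedMap f i) (inducedMap_add i)) f s

end inducedMap

/-- A morphism inducing isomorphisms on all factors is an isomorphism, by the five lemma along the
chain. -/
theorem isIso_of_bijective_inducedMap {M N : ChainModule.{u, v} S n} (f : M ⟶ N)
    (h : ∀ i, Function.Bijective (inducedMap f i)) : IsIso f := by
  have key : ∀ j : Fin (n + 1), (∀ x ∈ M.sub j, Hom.toLin f x = 0 → x = 0) ∧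
      ∀ y ∈ N.sub j, ∃ x ∈ M.sub j, Hom.toLin f x = y := by
    intro j
    induction j using Fin.induction with
    | zero =>
      refine ⟨fun x hx _ => by simpa [M.sub_zero] using hx, fun y hy => ⟨0, zero_mem _, ?_⟩⟩
      rw [N.sub_zero, Submodule.mem_bot] at hy
      rw [hy, map_zero]
    | succ i ih =>
      refine ⟨fun x hx h0 => ih.1 x ?_ h0, fun y hy => ?_⟩
      · have h1 : (Submodule.Quotient.mk ⟨x, hx⟩ : M.Factor i) = 0 := by
          refine (h i).1 ?_
          rw [inducedMap_mk, map_zero, Submodule.Quotient.mk_eq_zero]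
          simp only [h0]
          exact zero_mem _
        rw [Submodule.Quotient.mk_eq_zero] at h1
        exact h1
      · obtain ⟨q, hq⟩ := (h i).2 (Submodule.Quotient.mk ⟨y, hy⟩)
        obtain ⟨x, rfl⟩ := Submodule.Quotient.mk_surjective _ q
        rw [inducedMap_mk, Submodule.Quotient.eq] at hq
        obtain ⟨z, hz, hzy⟩ := ih.2 _ hq
        refine ⟨x - z, sub_mem x.2 (M.monotone_sub i.castSucc_lt_succ.le hz), ?_⟩
        rw [map_sub, hzy]
        simp
  have hinj : Function.Injective (Hom.toLin f) :=
    (injective_iff_map_eq_zero _).2 fun x hx =>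
      (key (Fin.last n)).1 x (M.sub_last ▸ Submodule.mem_top) hx
  have hsurj : Function.Surjective (Hom.toLin f) := fun y => by
    obtain ⟨x, -, hx⟩ := (key (Fin.last n)).2 y (N.sub_last ▸ Submodule.mem_top)
    exact ⟨x, hx⟩
  let e := LinearEquiv.ofBijective (Hom.toLin f) ⟨hinj, hsurj⟩
  refine ⟨⟨e.symm.toLinearMap, fun j y hy => ?_⟩, ?_, ?_⟩
  · obtain ⟨x, hx, rfl⟩ := (key j).2 y hy
    have : e.symm (Hom.toLin f x) = x := e.symm_apply_apply x
    rw [LinearEquiv.coe_coe, this]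
    exact hx
  · exact hom_ext fun x => e.symm_apply_apply x
  · exact hom_ext fun y => e.apply_symm_apply y

/-- The projections and injections of `directSum M`. -/
def directSumBicone {r : ℕ} (M : Fin r → ChainModule.{u, v} S n) : Limits.Bicone M where
  pt := directSum M
  π k := ⟨LinearMap.proj k, fun j x hx => hx k trivial⟩
  ι k := ⟨LinearMap.single S (fun k => (M k).carrier) k, fun j x hx k' _ => by
    by_cases h : k' = k
    · subst h
      simpa using hx
    · simp [h]⟩
  ι_π k k' := by
    split_ifs with h
    · subst h
      refine hom_ext fun x => ?_
      exact Pi.single_eq_same (M := fun k => (M k).carrier) k x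
    · refine hom_ext fun x => ?_
      exact Pi.single_eq_of_ne (M := fun k => (M k).carrier) (Ne.symm h) x

theorem directSumBicone_total {r : ℕ} (M : Fin r → ChainModule.{u, v} S n) :
    ∑ k, (directSumBicone M).π k ≫ (directSumBicone M).ι k = 𝟙 (directSumBicone M).pt := by
  refine hom_ext fun x => ?_
  rw [toLin_sum, LinearMap.sum_apply]
  exact Finset.univ_sum_single (M := fun k => (M k).carrier) x

/-! ### Monogeny and epigeny classes -/

/-- The property of the `i`-th induced map which defines the class of kind `a`. -/
def Regular (i : Fin n) : Kind → ∀ {M N : ChainModule.{u, v} S n}, (M ⟶ N) → Prop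
  | Kind.m, _, _, f => Function.Injective (inducedMap f i)
  | Kind.e, _, _, f => Function.Surjective (inducedMap f i)

theorem sameClass_iff (i : Fin n) (a : Kind) (M N : ChainModule.{u, v} S n) :
    SameClass i a M N ↔ ∃ (f : M ⟶ N) (g : N ⟶ M), Regular i a f ∧ Regular i a g := by
  cases a <;> rfl

theorem regular_id (i : Fin n) (a : Kind) (M : ChainModule.{u, v} S n) : Regular i a (𝟙 M) := by
  cases a <;> rw [Regular, inducedMap_id]
  · exact Function.injective_id
  · exact Function.surjective_id

theorem Regular.comp {i : Fin n} {a : Kind} {L M N : ChainModule.{u, v} S n} {f : L ⟶ M}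
    {g : M ⟶ N} (hf : Regular i a f) (hg : Regular i a g) : Regular i a (f ≫ g) := by
  cases a <;> simp only [Regular, inducedMap_comp] at * <;> simpa using hg.comp hf

/-- Having the same class is an equivalence relation. -/
def classSetoid (S : Type u) [Ring S] {n : ℕ} (i : Fin n) (a : Kind) :
    Setoid (ChainModule.{u, v} S n) where
  r := SameClass i a
  iseqv := by
    refine ⟨fun M => ?_, fun {M N} h => ?_, fun {L M N} h h' => ?_⟩
    · rw [sameClass_iff]
      exact ⟨𝟙 M, 𝟙 M, regular_id i a M, regular_id i a M⟩
    · rw [sameClass_iff] at *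
      obtain ⟨f, g, hf, hg⟩ := h
      exact ⟨g, f, hg, hf⟩
    · rw [sameClass_iff] at *
      obtain ⟨f, g, hf, hg⟩ := h
      obtain ⟨f', g', hf', hg'⟩ := h'
      exact ⟨f ≫ f', g' ≫ g, hf.comp hf', hg'.comp hg⟩

theorem regular_comp_iff {i : Fin n} {a : Kind} {L M N : ChainModule.{u, v} S n} (hL : L.IsU)
    (hM : M.IsU) (hN : N.IsU) {f : L ⟶ M} {g : M ⟶ N} :
    Regular i a (f ≫ g) ↔ Regular i a f ∧ Regular i a g := by
  have := (hL i).1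
  have := (hN i).1
  cases a <;> simp only [Regular, inducedMap_comp]
  · exact (hM i).2.injective_comp_iff
  · exact (hM i).2.surjective_comp_iff

/-- The completely prime ideal of `𝒰_n` of the morphisms whose `i`-th induced map is not injective
(for `a = m`), respectively not surjective (for `a = e`). -/
def regularIdeal (S : Type u) [Ring S] {n : ℕ} (i : Fin n) (a : Kind) :
    CompletelyPrimeIdeal (Subtype.val : {M : ChainModule.{u, v} S n // M.IsU} → _) where
  hom M N :=
    { carrier := {f | ¬ Regular i a f}
      zero_mem' := by
        have := (M.2 i).1
        have := (N.2 i).1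
        cases a <;> simp only [Set.mem_ofPred_eq, Regular, inducedMap_zero]
        · intro h
          obtain ⟨x, hx⟩ := exists_ne (0 : M.1.Factor i)
          exact hx (h rfl)
        · intro h
          obtain ⟨y, hy⟩ := exists_ne (0 : N.1.Factor i)
          obtain ⟨x, hx⟩ := h y
          exact hy hx.symm
      add_mem' := fun {f g} hf hg => by
        cases a <;> simp only [Set.mem_ofPred_eq, Regular, inducedMap_add] at *
        · exact (M.2 i).2.not_injective_add hf hg
        · exact (N.2 i).2.not_surjective_add hf hg
      neg_mem' := fun {f} hf => by
        cases a <;> simp only [Set.mem_ofPred_eq, Regular, inducedMap_neg] at *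
        · exact fun h => hf fun x y hxy => h (congrArg Neg.neg hxy)
        · exact fun h => hf fun y => (h (-y)).imp fun x hx => neg_injective hx }
  comp_mem_iff {L M N} f g :=
    (not_congr (regular_comp_iff L.2 M.2 N.2)).trans not_and_or
  id_notMem M h := h (regular_id i a M.1)

theorem notMem_regularIdeal {i : Fin n} {a : Kind} {M N : {M : ChainModule.{u, v} S n // M.IsU}}
    {f : M.1 ⟶ N.1} : f ∉ (regularIdeal S i a).hom M N ↔ Regular i a f := not_not

instance : Finite Kind :=
  Finite.of_injective (fun a : Kind => match a with | Kind.m => true | Kind.e => false)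
    (by rintro (_ | _) (_ | _) h <;> simp_all)

theorem isIso_of_regular {M N : ChainModule.{u, v} S n} (f : M ⟶ N) (h : ∀ i a, Regular i a f) :
    IsIso f :=
  isIso_of_bijective_inducedMap f fun i => ⟨h i Kind.m, h i Kind.e⟩

/-! ### Direct sums and classes -/

/-- **Necessity.** If `⊕ M k` and `⊕ N l` are isomorphic, then every class has at most as many
representatives among the `M k` as among the `N l`. -/
theorem card_class_le {κ ι : Type*} [Fintype κ] [Fintype ι] {M : κ → ChainModule.{u, v} S n}
    {N : ι → ChainModule.{u, v} S n} (hM : ∀ k, (M k).IsU) (hN : ∀ l, (N l).IsU)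
    (b : Limits.Bicone M) (c : Limits.Bicone N) (hc : ∑ l, c.π l ≫ c.ι l = 𝟙 c.pt)
    (e : b.pt ≅ c.pt) (i : Fin n) (a : Kind)
    (q : Quotient (classSetoid.{u, v} S i a)) [DecidableEq (Quotient (classSetoid.{u, v} S i a))] :
    (Finset.univ.filter fun k => Quotient.mk (classSetoid S i a) (M k) = q).card ≤
      (Finset.univ.filter fun l => Quotient.mk (classSetoid S i a) (N l) = q).card := by
  let f : ∀ k l, M k ⟶ N l := fun k l => b.ι k ≫ e.hom ≫ c.π l
  let g : ∀ l k, N l ⟶ M k := fun l k => c.ι l ≫ e.inv ≫ b.π k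
  have hsum : ∀ k k', ∑ l, f k l ≫ g l k' = b.ι k ≫ b.π k' := fun k k' => by
    calc ∑ l, f k l ≫ g l k' = b.ι k ≫ e.hom ≫ (∑ l, c.π l ≫ c.ι l) ≫ e.inv ≫ b.π k' := by
          simp only [f, g, Preadditive.sum_comp, Preadditive.comp_sum, Category.assoc]
      _ = b.ι k ≫ b.π k' := by rw [hc, Category.id_comp, e.hom_inv_id_assoc]
  have hsum' : ∀ k k', ∑ l, inducedMap (g l k') i ∘ₗ inducedMap (f k l) i =
      inducedMap (b.ι k ≫ b.π k') i := fun k k' => by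
    simp only [← hsum, inducedMap_sum, inducedMap_comp]
  have hid : ∀ k, ∑ l, inducedMap (g l k) i ∘ₗ inducedMap (f k l) i = LinearMap.id := fun k => by
    rw [hsum', Limits.bicone_ι_π_self, inducedMap_id]
  have hzero : ∀ k k', k ≠ k' → ∑ l, inducedMap (g l k') i ∘ₗ inducedMap (f k l) i = 0 :=
    fun k k' hne => by rw [hsum', Limits.bicone_ι_π_ne b hne, inducedMap_zero]
  -- A path that leaves the class cannot be outside the ideal.
  have hpath : ∀ k ∈ Finset.univ.filter fun k => Quotient.mk (classSetoid S i a) (M k) = q,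
      ∀ k' ∈ Finset.univ.filter fun k => Quotient.mk (classSetoid S i a) (M k) = q,
      ∀ l ∉ Finset.univ.filter fun l => Quotient.mk (classSetoid S i a) (N l) = q,
      ¬ Regular i a (f k l ≫ g l k') := by
    intro k hk k' hk' l hl hreg
    simp only [Finset.mem_filter, Finset.mem_univ, true_and] at hk hk' hl
    rw [regular_comp_iff (hM k) (hN l) (hM k')] at hreg
    obtain ⟨p, -, hp, -⟩ := (sameClass_iff i a _ _).1 (Quotient.exact (hk'.trans hk.symm))
    refine hl ((Quotient.sound ?_).trans hk)
    exact (sameClass_iff i a _ _).2 ⟨g l k' ≫ p, f k l, hreg.2.comp hp, hreg.1⟩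
  have hnt : ∀ k, Nontrivial ((M k).Factor i) := fun k => (hM k i).1
  cases a
  · refine card_le_of_not_injective (fun k => (hM k i).2) (fun l => (hN l i).2)
      (fun k l => inducedMap (f k l) i) (fun l k => inducedMap (g l k) i) hid hzero _ _ ?_
    simpa only [Regular, inducedMap_comp] using hpath
  · refine card_le_of_not_surjective (fun k => (hM k i).2) (fun l => (hN l i).2)
      (fun k l => inducedMap (f k l) i) (fun l k => inducedMap (g l k) i) hid hzero _ _ ?_
    simpa only [Regular, inducedMap_comp] using hpath

theorem exists_equiv_of_iso {r s : ℕ} {M : Fin r → ChainModule.{u, v} S n}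
    {N : Fin s → ChainModule.{u, v} S n} (hM : ∀ k, (M k).IsU) (hN : ∀ l, (N l).IsU)
    (e : directSum M ≅ directSum N) (i : Fin n) (a : Kind) :
    ∃ σ : Fin r ≃ Fin s, ∀ k, SameClass i a (M k) (N (σ k)) := by
  classical
  obtain ⟨σ, hσ⟩ := exists_equiv_of_card_fiber_eq
    (fun k => Quotient.mk (classSetoid S i a) (M k))
    (fun l => Quotient.mk (classSetoid S i a) (N l))
    fun c => le_antisymm
      (card_class_le hM hN (directSumBicone M) (directSumBicone N) (directSumBicone_total N) e
        i a c)
      (card_class_le hN hM (directSumBicone N) (directSumBicone M) (directSumBicone_total M) e.symm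
        i a c)
  exact ⟨σ, fun k => Quotient.exact (hσ k).symm⟩

theorem nonempty_iso_of_equiv {r s : ℕ} {M : Fin r → ChainModule.{u, v} S n}
    {N : Fin s → ChainModule.{u, v} S n} (hM : ∀ k, (M k).IsU) (hN : ∀ l, (N l).IsU)
    (σ : Fin n → Kind → (Fin r ≃ Fin s)) (hσ : ∀ i a k, SameClass i a (M k) (N (σ i a k))) :
    Nonempty (directSum M ≅ directSum N) :=
  CompletelyPrimeIdeal.nonempty_iso (fun t : Fin n × Kind => regularIdeal S t.1 t.2)
    (fun _ f hf => isIso_of_regular f fun i a => notMem_regularIdeal.1 (hf (i, a)))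
    (M := fun k => ⟨M k, hM k⟩) (N := fun l => ⟨N l, hN l⟩)
    (directSumBicone M) (directSumBicone N) (directSumBicone_total M) (directSumBicone_total N)
    (fun t => σ t.1 t.2) fun t k => by
      obtain ⟨f, g, hf, hg⟩ := (sameClass_iff _ _ _ _).1 (hσ t.1 t.2 k)
      exact ⟨f, g, notMem_regularIdeal.2 hf, notMem_regularIdeal.2 hg⟩

end ChainModule

theorem proposition4p6 (R : Type u) [Ring R] (n : ℕ) (hn : 0 < n) (r s : ℕ)
    (M : Fin r → ChainModule.{u, v} Rᵐᵒᵖ n) (N : Fin s → ChainModule.{u, v} Rᵐᵒᵖ n)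
    (hM : ∀ k, (M k).IsU) (hN : ∀ l, (N l).IsU) :
    Nonempty (ChainModule.directSum M ≅ ChainModule.directSum N) ↔
      ∃ h : r = s, ∃ φ : Fin n → ChainModule.Kind → Equiv.Perm (Fin r),
        ∀ (i : Fin n) (a : ChainModule.Kind) (k : Fin r),
          ChainModule.SameClass i a (M k) (N (Fin.cast h (φ i a k))) := by
  constructor
  · rintro ⟨e⟩
    choose σ hσ using ChainModule.exists_equiv_of_iso hM hN e
    -- Any one of the bijections gives `r = s`; there is one because `0 < n`.
    obtain rfl : r = s := by simpa using Fintype.card_congr (σ ⟨0, hn⟩ ChainModule.Kind.m)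
    exact ⟨rfl, σ, hσ⟩
  · rintro ⟨rfl, φ, hφ⟩
    exact ChainModule.nonempty_iso_of_equiv hM hN φ hφ
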